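/- Let $\mathbb K$ be $\mathbb R$ or $\mathbb C$, and let $X$ be a Hausdorff topological vector space over $\mathbb K$ with dual $X'$ (the space of continuous linear functionals on $X$). Assume that $X$ belongs to the class $\mathcal M$, that is: (a) there is a dense linear subspace $Y$ of $X$ admitting a topology $\tau$, finer than the topology inherited from $X$, such that $(Y,\tau)$ is a separable $\mathcal F$-space (an $\mathcal F$-space is a complete metrizable topological vector space); and (b) there is a linearly independent equicontinuous sequence $(f_n)_{n\ge 0}$ in $X'$, where equicontinuous means that for some neighbourhood $U$ of zero in $X$, $|f_n(x)|\le 1$ for all $x\in U$ and all $n$. Then for every integer $k\ge 1$ there is a family $\{T_t\}_{t\in\mathbb K^k}$ of continuous linear operators on $X$ with the following properties, where $|\cdot|$ is the Euclidean norm on $\mathbb K^k$: 1. (operator group) $T_0=I$ and $T_{s+t}=T_tT_s$ for all $s,t\in\mathbb K^k$; 2. (uniformly continuous) there is a neighbourhood $U$ of zero in $X$ such that whenever $t_n\to t$ in $\mathbb K^k$, $T_{t_n}x\to T_tx$ uniformly for $x\in U$; 3. (hereditarily hypercyclic) for every sequence $(t_n)_{n\ge 0}$ in $\mathbb K^k$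 with $|t_n|\to\infty$ there is $x\in X$ such that $\{T_{t_n}x:n\ge 0\}$ is dense in $X$; and therefore also 4. (mixing) for all non-empty open $U,V\subseteq X$ there is $r>0$ such that $T_t(U)\cap V\ne\varnothing$ for all $t\in\mathbb K^k$ with $|t|>r$; 5. for all $x\in X$ and $f\in X'$, the map $z\mapsto f(T_zx)$ from $\mathbb K^k$ to $\mathbb K$ is analytic (real-analytic if $\mathbb K=\mathbb R$, holomorphic if $\mathbb K=\mathbb C$). -/

import Mathlib

open Filter Topology

/-- An F-space over `𝕜`: a complete metrizable topological vector space. Completeness refers to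
the canonical (translation invariant) uniformity of the additive topological group `E`. -/
structure IsFSpace (𝕜 E : Type*) [RCLike 𝕜] [AddCommGroup E] [Module 𝕜 E]
    [TopologicalSpace E] : Prop where
  isTopologicalAddGroup : IsTopologicalAddGroup E
  continuousSMul : ContinuousSMul 𝕜 E
  metrizableSpace : TopologicalSpace.MetrizableSpace E
  completeSpace : @CompleteSpace E (IsTopologicalAddGroup.rightUniformSpace E)

/-- The class `M₀`: some dense linear subspace `Y` of `X` carries a topology `τ`, finer than the
one inherited from `X`, for which `(Y, τ)` is a separable F-space. -/
def ClassM₀ (𝕜 X : Type*) [RCLike 𝕜] [AddCommGroup X] [Module 𝕜 X]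
    [TopologicalSpace X] : Prop :=
  ∃ Y : Submodule 𝕜 X, Dense (Y : Set X) ∧
    ∃ τ : TopologicalSpace Y, τ ≤ (instTopologicalSpaceSubtype : TopologicalSpace Y) ∧
      @IsFSpace 𝕜 Y _ _ _ τ ∧ @TopologicalSpace.SeparableSpace Y τ

/-- A set `A` of continuous linear functionals is equicontinuous if for some neighbourhood `U`
of zero, `|f(x)| ≤ 1` for all `x ∈ U` and `f ∈ A`. -/
def IsEquicontinuousSet {𝕜 X : Type*} [RCLike 𝕜] [AddCommGroup X] [Module 𝕜 X]
    [TopologicalSpace X] (A : Set (X →L[𝕜] 𝕜)) : Prop :=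
  ∃ U ∈ 𝓝 (0 : X), ∀ f ∈ A, ∀ x ∈ U, ‖f x‖ ≤ 1

/-- The class `M₁`: the dual `X'` contains a linearly independent equicontinuous sequence. -/
def ClassM₁ (𝕜 X : Type*) [RCLike 𝕜] [AddCommGroup X] [Module 𝕜 X]
    [TopologicalSpace X] : Prop :=
  ∃ f : ℕ → (X →L[𝕜] 𝕜), LinearIndependent 𝕜 f ∧ IsEquicontinuousSet (Set.range f)

/-- The class `M = M₀ ∩ M₁`. -/
def ClassM (𝕜 X : Type*) [RCLike 𝕜] [AddCommGroup X] [Module 𝕜 X]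
    [TopologicalSpace X] : Prop :=
  ClassM₀ 𝕜 X ∧ ClassM₁ 𝕜 X

/-- A family of maps is universal if `{S i x : i}` is dense for some point `x`. -/
def IsUniversalFamily {ι X Y : Type*} [TopologicalSpace Y] (S : ι → X → Y) : Prop :=
  ∃ x : X, Dense (Set.range fun i => S i x)

section OperatorSemigroups

variable {𝕜 X A : Type*} [RCLike 𝕜] [AddCommGroup X] [Module 𝕜 X] [TopologicalSpace X]

/-- `T 0 = I` and `T (s + t) = T t ∘ T s`. When the index monoid `A` is a group, this is an
operator group. -/
def IsOperatorSemigroup [AddCommMonoid A] (T : A → (X →L[𝕜] X)) : Prop :=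
  T 0 = ContinuousLinearMap.id 𝕜 X ∧ ∀ s t : A, T (s + t) = (T t).comp (T s)

/-- There is a neighbourhood `U` of zero such that `T (t n) x → T a x` uniformly in `x ∈ U`
whenever `t n → a` in `A`. Uniformity is that of the topological vector space `X`. -/
def IsUniformlyContinuousFamily [TopologicalSpace A] (T : A → (X →L[𝕜] X)) : Prop :=
  ∃ U ∈ 𝓝 (0 : X), ∀ (t : ℕ → A) (a : A), Tendsto t atTop (𝓝 a) →
    ∀ W ∈ 𝓝 (0 : X), ∀ᶠ n in atTop, ∀ x ∈ U, T (t n) x - T a x ∈ W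

/-- `{T (t n) : n}` is universal for every sequence `t` in `A` with `‖t n‖ → ∞`. -/
def IsHereditarilyHypercyclic [Norm A] (T : A → (X →L[𝕜] X)) : Prop :=
  ∀ t : ℕ → A, Tendsto (fun n => ‖t n‖) atTop atTop →
    IsUniversalFamily fun (n : ℕ) (x : X) => T (t n) x

/-- For all non-empty open `U`, `V` there is `r > 0` such that `T t (U)` meets `V` whenever
`‖t‖ > r`. -/
def IsMixing [Norm A] (T : A → (X →L[𝕜] X)) : Prop :=
  ∀ U V : Set X, IsOpen U → IsOpen V → U.Nonempty → V.Nonempty →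
    ∃ r : ℝ, 0 < r ∧ ∀ t : A, r < ‖t‖ → ((T t '' U) ∩ V).Nonempty

end OperatorSemigroups

/-! The group is an exponential `exp (∑ i, z i • J ∘ B i ∘ G)` factored through `ℓ¹` over the
multi-indices. On polynomials the operator `exp (∑ i, z i • ∂ᵢ)` is, by Taylor's formula,
translation by `z`, and the construction transports this model into `X`.

Gram–Schmidt in `Y` turns the equicontinuous sequence into functionals biorthogonal to vectors with
dense span. Rescaling both gives `G : X → ℓ¹` and `J : ℓ¹ → X`, with `J` of dense range and `G ∘ J`
diagonal with nonzero entries (`ClassM.exists_diagonal_factorization`). Weighted backward shifts `B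
i` on `ℓ¹` are chosen so that `B i ∘ G ∘ J` acts as `∂ᵢ` on a dense copy of the polynomials
(`exists_weighted_backward_shifts`, `shift_polyToLp`).

As `X` need not be complete, the exponential is taken of a block operator on `ℓ¹ × ℓ¹`. Uniform
continuity and analyticity come from those of the Banach algebra exponential. The group `T` on `X`
and the group `S` on `ℓ¹` satisfy `T z ∘ J = J ∘ S z` (`factoredExp_comp`), so mixing and dense
orbits pass from `ℓ¹` to `X`, which need not be a Baire space.

For mixing of `S`, let `z j` be the largest coordinate of `z` and `N` a large fixed exponent. The
polynomial `(X j / z j) ^ N * p(y - z) + q * (1 - X j / z j) ^ N` tends to `q` as `z → ∞`, and its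
translate by `z` tends to `p`. -/

/-! ### Translations and Taylor's formula for polynomials. -/

section PolynomialTranslation

open MvPolynomial

variable {𝕜 ι E : Type*} [RCLike 𝕜]

/-- The substitution `p(y) ↦ p(y + z)`. -/
noncomputable def translatePoly (z : ι → 𝕜) : MvPolynomial ι 𝕜 →ₐ[𝕜] MvPolynomial ι 𝕜 :=
  aeval fun i => X i + C (z i)

/-- The directional derivative of polynomials along `z`. -/
noncomputable def directionalDeriv (z : ι → 𝕜) :
    Derivation 𝕜 (MvPolynomial ι 𝕜) (MvPolynomial ι 𝕜) :=
  mkDerivation 𝕜 fun i => C (z i)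

theorem translatePoly_X (z : ι → 𝕜) (i : ι) : translatePoly z (X i) = X i + C (z i) := by
  simp [translatePoly]

theorem translatePoly_C (z : ι → 𝕜) (c : 𝕜) : translatePoly z (C c) = C c := by
  simp [translatePoly]

theorem translatePoly_translatePoly_neg (z : ι → 𝕜) (p : MvPolynomial ι 𝕜) :
    translatePoly z (translatePoly (-z) p) = p := by
  have : (translatePoly z).comp (translatePoly (-z)) = AlgHom.id 𝕜 _ := by
    ext1 i
    simp [translatePoly_X]
  exact DFunLike.congr_fun this p

theorem directionalDeriv_eq_sum [Fintype ι] (z : ι → 𝕜) (p : MvPolynomial ι 𝕜) :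
    directionalDeriv z p = ∑ i, z i • pderiv i p := by
  classical
  have h (q : MvPolynomial ι 𝕜) (s : Finset ι) : (∑ i ∈ s, z i • pderiv (R := 𝕜) i) q
      = ∑ i ∈ s, z i • (pderiv (R := 𝕜) i) q := by
    induction s using Finset.induction_on with
    | empty => simp
    | insert a s ha ih => rw [Finset.sum_insert ha, Finset.sum_insert ha, ← ih]; rfl
  have hD : directionalDeriv z = ∑ i, z i • pderiv (R := 𝕜) i := by
    refine derivation_ext fun j => ?_
    rw [directionalDeriv, mkDerivation_X, h]
    simp [pderiv_X, Pi.single_apply, smul_eq_C_mul]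
  rw [hD, h]

/-- The derivative of `X i` is the constant `z i`, so only two terms of the iterated Leibniz rule
survive. -/
theorem iterate_directionalDeriv_succ_X_mul (z : ι → 𝕜) (i : ι) (p : MvPolynomial ι 𝕜) (m : ℕ) :
    (directionalDeriv z)^[m + 1] (X i * p) =
      X i * (directionalDeriv z)^[m + 1] p
        + ((m + 1 : ℕ) * z i : 𝕜) • (directionalDeriv z)^[m] p := by
  have h1 (q : MvPolynomial ι 𝕜) :
      directionalDeriv z (X i * q) = X i * directionalDeriv z q + z i • q := by
    rw [Derivation.leibniz]
    simp [directionalDeriv, mkDerivation_X, smul_eq_C_mul, mul_comm]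
  induction m with
  | zero => simp [h1]
  | succ m ih =>
    rw [Function.iterate_succ_apply', ih, map_add, h1, Derivation.map_smul,
      ← Function.iterate_succ_apply' (directionalDeriv z) (m + 1) p,
      ← Function.iterate_succ_apply' (directionalDeriv z) m p, add_assoc, ← add_smul]
    congr 2
    push_cast
    ring

/-- Taylor's formula for polynomials, tested against linear maps. -/
theorem hasSum_directionalDeriv [AddCommGroup E] [Module 𝕜 E] [TopologicalSpace E]
    [IsTopologicalAddGroup E] [ContinuousSMul 𝕜 E] (z : ι → 𝕜) (p : MvPolynomial ι 𝕜)
    (L : MvPolynomial ι 𝕜 →ₗ[𝕜] E) :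
    HasSum (fun m : ℕ => ((m.factorial : 𝕜)⁻¹) • L ((directionalDeriv z)^[m] p))
      (L (translatePoly z p)) := by
  induction p using MvPolynomial.induction_on generalizing L with
  | C a =>
    have h := hasSum_single (f := fun m : ℕ =>
      ((m.factorial : 𝕜)⁻¹) • L ((directionalDeriv z)^[m] (C a))) 0 (fun m hm => by
        obtain ⟨n, rfl⟩ := Nat.exists_eq_succ_of_ne_zero hm
        have h0 : ∀ n : ℕ, (directionalDeriv z)^[n] (0 : MvPolynomial ι 𝕜) = 0 := fun n =>
          Function.iterate_fixed (map_zero _) n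
        rw [Function.iterate_succ_apply, derivation_C, h0, map_zero, smul_zero])
    simpa [translatePoly_C] using h
  | add p q hp hq =>
    convert (hp L).add (hq L) using 1
    · funext m
      rw [← smul_add, ← map_add, iterate_map_add]
    · simp
  | mul_X p i ih =>
    have h1 := ih (L.comp (LinearMap.mulLeft 𝕜 (X i)))
    have h2 := (ih L).const_smul (z i)
    -- The Leibniz recursion starts at order one, so the zeroth terms are split off.
    rw [hasSum_nat_add_iff' 1 |>.symm] at h1
    rw [mul_comm, ← hasSum_nat_add_iff' 1]
    convert h1.add h2 using 1
    · funext m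
      rw [iterate_directionalDeriv_succ_X_mul, map_add, map_smul, smul_add, smul_smul, smul_smul]
      congr 2
      rw [Nat.factorial_succ]
      have : ((m + 1 : ℕ) : 𝕜) ≠ 0 := Nat.cast_ne_zero.2 m.succ_ne_zero
      have : (m.factorial : 𝕜) ≠ 0 := Nat.cast_ne_zero.2 m.factorial_ne_zero
      push_cast at *
      field_simp
    · rw [map_mul, translatePoly_X, add_mul, map_add, ← smul_eq_C_mul, map_smul]
      simp only [Finset.range_one, Finset.sum_singleton, Function.iterate_zero, id,
        LinearMap.comp_apply, LinearMap.mulLeft_apply]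
      abel

/-- Multiplying the translate of a polynomial by a high power of `X j / z j`, where `z j` is the
largest coordinate of `z`, makes it small as `z j → ∞`. -/
theorem exists_tendsto_translatePoly_mul_pow_zero [NormedAddCommGroup E] [NormedSpace 𝕜 E]
    (j : ι) (l : Filter (ι → 𝕜)) (hl : Tendsto (fun z => ‖z j‖) l atTop)
    (hmax : ∀ᶠ z in l, ∀ i, ‖z i‖ ≤ ‖z j‖) (p : MvPolynomial ι 𝕜) :
    ∃ N₀ : ℕ, ∀ N ≥ N₀, ∀ L : MvPolynomial ι 𝕜 →ₗ[𝕜] E,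
      Tendsto (fun z => ((z j)⁻¹ ^ N) • L (translatePoly z p * X j ^ N)) l (𝓝 0) := by
  have hinv : Tendsto (fun z : ι → 𝕜 => (z j)⁻¹) l (𝓝 0) := by
    rw [tendsto_zero_iff_norm_tendsto_zero]
    simp only [norm_inv]
    exact tendsto_inv_atTop_zero.comp hl
  induction p using MvPolynomial.induction_on with
  | C a =>
    refine ⟨1, fun N hN L => ?_⟩
    simp only [translatePoly_C]
    have h := (hinv.pow N).smul_const (L (C a * X j ^ N))
    rwa [zero_pow (by omega), zero_smul] at h
  | add p q hp hq =>
    obtain ⟨N₁, h₁⟩ := hp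
    obtain ⟨N₂, h₂⟩ := hq
    refine ⟨max N₁ N₂, fun N hN L => ?_⟩
    have h := (h₁ N (le_of_max_le_left hN) L).add (h₂ N (le_of_max_le_right hN) L)
    rw [add_zero] at h
    refine h.congr fun z => ?_
    rw [map_add, add_mul, map_add, smul_add]
  | mul_X p i ih =>
    obtain ⟨N₀, h₀⟩ := ih
    -- The new factor translates to `X i + z i`; one extra power of `(z j)⁻¹` absorbs `z i`, because
    -- `‖z i‖ ≤ ‖z j‖`.
    refine ⟨N₀ + 1, fun N hN L => ?_⟩
    obtain ⟨M, rfl⟩ : ∃ M, N = M + 1 := ⟨N - 1, by omega⟩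
    have h₁ := h₀ (M + 1) (by omega) (L.comp (LinearMap.mulLeft 𝕜 (X i)))
    have h₂ := h₀ M (by omega) (L.comp (LinearMap.mulLeft 𝕜 (X j)))
    have h₃ : Tendsto (fun z : ι → 𝕜 => (z i * (z j)⁻¹) •
        ((z j)⁻¹ ^ M • (L.comp (LinearMap.mulLeft 𝕜 (X j))) (translatePoly z p * X j ^ M)))
        l (𝓝 0) := by
      refine squeeze_zero_norm' ?_ (tendsto_zero_iff_norm_tendsto_zero.1 h₂)
      filter_upwards [hmax] with z hz
      rw [norm_smul]
      refine mul_le_of_le_one_left (norm_nonneg _) ?_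
      rw [norm_mul, norm_inv, ← div_eq_mul_inv]
      exact div_le_one_of_le₀ (hz i) (norm_nonneg _)
    have h := h₁.add h₃
    rw [add_zero] at h
    refine h.congr fun z => ?_
    have e1 : translatePoly z (p * X i) * X j ^ (M + 1)
        = X i * (translatePoly z p * X j ^ (M + 1))
          + z i • (X j * (translatePoly z p * X j ^ M)) := by
      rw [map_mul, translatePoly_X, smul_eq_C_mul]
      ring
    rw [e1, map_add, map_smul, smul_add, smul_smul, smul_smul]
    simp only [LinearMap.comp_apply, LinearMap.mulLeft_apply]
    congr 2
    ring

/-- With `N` fixed, the argument of `L` is a polynomial in `c a` with fixed coefficients, so `L`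
needs no continuity. Quantifying over all `L` lets the induction absorb multiplication by `X j`. -/
theorem tendsto_mul_one_add_smul_X_pow [NormedAddCommGroup E] [NormedSpace 𝕜 E]
    {α : Type*} (l : Filter α) (c : α → 𝕜) (hc : Tendsto c l (𝓝 0)) (j : ι) (N : ℕ)
    (p : MvPolynomial ι 𝕜) (L : MvPolynomial ι 𝕜 →ₗ[𝕜] E) :
    Tendsto (fun a => L (p * (1 + c a • X j) ^ N)) l (𝓝 (L p)) := by
  induction N generalizing L with
  | zero => simpa using tendsto_const_nhds
  | succ N ih =>
    have h := (ih L).add (hc.smul (ih (L.comp (LinearMap.mulLeft 𝕜 (X j)))))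
    rw [zero_smul, add_zero] at h
    refine h.congr fun a => ?_
    rw [LinearMap.comp_apply, LinearMap.mulLeft_apply, ← map_smul, ← map_add]
    congr 1
    rw [pow_succ, smul_eq_C_mul, smul_eq_C_mul]
    ring

end PolynomialTranslation

/-! ### Gram–Schmidt biorthogonalization. -/

section BiorthogonalSequences

/-- Dependent choice of a sequence whose every term is constrained by all the previous ones. -/
theorem exists_seq_of_forall_exists_extension {α : Type*} [Nonempty α]
    (P : ∀ n : ℕ, (Fin n → α) → α → Prop)
    (h : ∀ (n : ℕ) (d : ℕ → α), (∀ m < n, P m (fun i => d i) (d m)) →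
      ∃ a, P n (fun i => d i) a) :
    ∃ d : ℕ → α, ∀ n, P n (fun i => d i) (d n) := by
  classical
  let F : ∀ n : ℕ, (Fin n → α) → α := fun n v =>
    if hv : ∃ a, P n v a then hv.choose else Classical.arbitrary α
  let d : ℕ → α := fun n => Nat.strongRec (fun n ih => F n fun i => ih i i.2) n
  have hd : ∀ n, d n = F n fun i => d i := fun n => by
    simp only [d]
    rw [Nat.strongRec]
  refine ⟨d, fun n => ?_⟩
  induction n using Nat.strong_induction_on with
  | _ n ih =>
    have hv := h n d ih
    rw [hd n]
    simp only [F]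
    rw [dif_pos hv]
    exact hv.choose_spec

/-- The inductive step of the Gram–Schmidt process for a sequence of functionals. -/
theorem exists_biorthogonal_extension {𝕜 Y W : Type*} [NontriviallyNormedField 𝕜]
    [AddCommGroup Y] [Module 𝕜 Y] [TopologicalSpace Y]
    [ContinuousSMul 𝕜 Y] [AddCommGroup W] [Module 𝕜 W]
    (B : W →ₗ[𝕜] Module.Dual 𝕜 Y) (hB : Function.Injective B)
    (V : Set Y) (hV : V ∈ 𝓝 (0 : Y)) (y : Y) (g : ℕ → W) (hg : LinearIndependent 𝕜 g)
    (n : ℕ) (x : Fin n → Y) (h : Fin n → W) (hh : ∀ i, h i ∈ Submodule.span 𝕜 (g '' Set.Iio n))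
    (hbi : ∀ i j, B (h i) (x j) = if i = j then 1 else 0) :
    ∃ (a : Y) (b : W), b ∈ Submodule.span 𝕜 (g '' Set.Iic n) ∧ B b a = 1 ∧
      (∀ i, B b (x i) = 0) ∧ (∀ i, B (h i) a = 0) ∧
      ∃ c : Fin n → 𝕜, a + ∑ i, c i • x i - y ∈ V := by
  obtain ⟨h', hh'⟩ : ∃ h' : W, h' = g n - ∑ i : Fin n, B (g n) (x i) • h i := ⟨_, rfl⟩
  have hsum : ∑ i : Fin n, B (g n) (x i) • h i ∈ Submodule.span 𝕜 (g '' Set.Iio n) := by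
    refine Submodule.sum_mem _ fun i _ => Submodule.smul_mem _ _ (hh i)
  have hne : h' ≠ 0 := by
    intro h0
    have hmem : g n ∈ Submodule.span 𝕜 (g '' Set.Iio n) := by
      rw [hh', sub_eq_zero] at h0
      rw [h0]
      exact hsum
    exact hg.notMem_span_image (s := Set.Iio n) (by simp) hmem
  have hspan : h' ∈ Submodule.span 𝕜 (g '' Set.Iic n) := by
    rw [hh']
    exact Submodule.sub_mem _ (Submodule.subset_span ⟨n, Set.mem_Iic.2 le_rfl, rfl⟩)
      (Submodule.span_mono (Set.image_mono Set.Iio_subset_Iic_self) hsum)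
  have hann : ∀ i : Fin n, B h' (x i) = 0 := by
    intro i
    rw [hh', map_sub, map_sum, LinearMap.sub_apply, LinearMap.sum_apply, sub_eq_zero]
    simp only [map_smul, LinearMap.smul_apply, hbi, smul_eq_mul, mul_ite, mul_one, mul_zero,
      Finset.sum_ite_eq', Finset.mem_univ, if_true]
  obtain ⟨w, hw⟩ : ∃ w, B h' w ≠ 0 := by
    by_contra! hall
    exact hne (hB (by rw [map_zero]; exact LinearMap.ext hall))
  -- `q` projects onto the common kernel of the earlier functionals; it does not change `B h'`,
  -- which kills every `x i`.
  obtain ⟨q, hq⟩ : ∃ q : Y → Y, ∀ v, q v = v - ∑ i : Fin n, B (h i) v • x i := ⟨_, fun _ => rfl⟩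
  have hq₁ : ∀ v (i : Fin n), B (h i) (q v) = 0 := by
    intro v i
    rw [hq, map_sub, map_sum, sub_eq_zero]
    simp only [map_smul, hbi, smul_eq_mul, mul_ite, mul_one, mul_zero,
      Finset.sum_ite_eq, Finset.mem_univ, if_true]
  have hq₂ : ∀ v, B h' (q v) = B h' v := by
    intro v
    rw [hq, map_sub, map_sum]
    simp only [map_smul, hann, smul_zero, Finset.sum_const_zero, sub_zero]
  -- If `B h'` vanishes at `y`, a small multiple of `q w` makes its value nonzero; otherwise `ε = 0`
  -- will do.
  obtain ⟨ε, hεV, hε⟩ : ∃ ε : 𝕜, ε • q w ∈ V ∧ B h' (q y + ε • q w) ≠ 0 := by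
    by_cases h0 : B h' y = 0
    · have ht : Tendsto (fun ε : 𝕜 => ε • q w) (𝓝[≠] 0) (𝓝 0) := by
        have : Tendsto (fun ε : 𝕜 => ε • q w) (𝓝 0) (𝓝 ((0 : 𝕜) • q w)) :=
          (continuous_id.smul continuous_const).tendsto 0
        rw [zero_smul] at this
        exact this.mono_left nhdsWithin_le_nhds
      obtain ⟨ε, h1, h2⟩ := ((ht.eventually hV).and self_mem_nhdsWithin).exists
      refine ⟨ε, h1, ?_⟩
      rw [map_add, map_smul, hq₂, hq₂, h0, zero_add, smul_eq_mul]
      exact mul_ne_zero h2 hw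
    · refine ⟨0, ?_, ?_⟩
      · rw [zero_smul]
        exact mem_of_mem_nhds hV
      · rwa [zero_smul, add_zero, hq₂]
  -- The coefficients `B (h i) y` restore what `q` removed from `y`, so the error is exactly `ε • q
  -- w`.
  refine ⟨q y + ε • q w, (B h' (q y + ε • q w))⁻¹ • h',
    Submodule.smul_mem _ _ hspan, ?_, ?_, ?_, fun i => B (h i) y, ?_⟩
  · rw [map_smul, LinearMap.smul_apply, smul_eq_mul, inv_mul_cancel₀ hε]
  · intro i
    rw [map_smul, LinearMap.smul_apply, hann, smul_zero]
  · intro i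
    rw [map_add, map_smul, hq₁, hq₁, smul_zero, add_zero]
  · convert hεV using 1
    simp only [hq]
    abel

/-- A Gram–Schmidt process: a linearly independent sequence of functionals can be made
biorthogonal to a sequence of vectors whose span contains small perturbations of given vectors. -/
theorem exists_biorthogonal_of_linearIndependent {𝕜 Y W : Type*} [NontriviallyNormedField 𝕜]
    [AddCommGroup Y] [Module 𝕜 Y] [TopologicalSpace Y]
    [ContinuousSMul 𝕜 Y] [AddCommGroup W] [Module 𝕜 W]
    (B : W →ₗ[𝕜] Module.Dual 𝕜 Y) (hB : Function.Injective B)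
    (V : ℕ → Set Y) (hV : ∀ n, V n ∈ 𝓝 (0 : Y)) (y : ℕ → Y)
    (g : ℕ → W) (hg : LinearIndependent 𝕜 g) :
    ∃ (x : ℕ → Y) (h : ℕ → W), (∀ n, h n ∈ Submodule.span 𝕜 (Set.range g)) ∧
      (∀ n, B (h n) (x n) = 1) ∧ (∀ m n, m ≠ n → B (h m) (x n) = 0) ∧
      ∀ n, ∃ y' ∈ Submodule.span 𝕜 (Set.range x), y' - y n ∈ V n := by
  let P : ∀ n : ℕ, (Fin n → Y × W) → Y × W → Prop := fun n v a =>
    a.2 ∈ Submodule.span 𝕜 (g '' Set.Iic n) ∧ B a.2 a.1 = 1 ∧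
      (∀ i, B a.2 (v i).1 = 0) ∧ (∀ i, B (v i).2 a.1 = 0) ∧
      ∃ c : Fin n → 𝕜, a.1 + ∑ i, c i • (v i).1 - y n ∈ V n
  obtain ⟨d, hd⟩ : ∃ d : ℕ → Y × W, ∀ n, P n (fun i => d i) (d n) := by
    refine exists_seq_of_forall_exists_extension P fun n d hd => ?_
    have hmem : ∀ i : Fin n, (d i).2 ∈ Submodule.span 𝕜 (g '' Set.Iio n) := fun i =>
      Submodule.span_mono (Set.image_mono (Set.Iic_subset_Iio.2 i.2)) (hd i i.2).1
    have hbi : ∀ i j : Fin n, B (d i).2 (d j).1 = if i = j then 1 else 0 := by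
      intro i j
      rcases lt_trichotomy i j with hij | rfl | hij
      · rw [if_neg hij.ne]
        exact (hd j j.2).2.2.2.1 ⟨i, hij⟩
      · rw [if_pos rfl]
        exact (hd i i.2).2.1
      · rw [if_neg hij.ne']
        exact (hd i i.2).2.2.1 ⟨j, hij⟩
    obtain ⟨a, b, hab⟩ := exists_biorthogonal_extension B hB (V n) (hV n) (y n) g hg n
      (fun i => (d i).1) (fun i => (d i).2) hmem hbi
    exact ⟨(a, b), hab⟩
  refine ⟨fun n => (d n).1, fun n => (d n).2, fun n => ?_, fun n => (hd n).2.1, ?_, fun n => ?_⟩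
  · exact Submodule.span_mono (Set.image_subset_range _ _) (hd n).1
  · intro m n hmn
    rcases hmn.lt_or_gt with h | h
    · exact (hd n).2.2.2.1 ⟨m, h⟩
    · exact (hd m).2.2.1 ⟨n, h⟩
  · obtain ⟨c, hc⟩ := (hd n).2.2.2.2
    refine ⟨_, ?_, hc⟩
    refine Submodule.add_mem _ (Submodule.subset_span ⟨n, rfl⟩)
      (Submodule.sum_mem _ fun i _ => Submodule.smul_mem _ _ (Submodule.subset_span ⟨i, rfl⟩))

/-- In a separable first countable topological vector space, the vectors of the biorthogonal
sequence can be chosen with dense span. -/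
theorem exists_biorthogonal_dense_span {𝕜 Y W : Type*} [NontriviallyNormedField 𝕜]
    [AddCommGroup Y] [Module 𝕜 Y] [TopologicalSpace Y]
    [IsTopologicalAddGroup Y] [ContinuousSMul 𝕜 Y]
    [FirstCountableTopology Y] [TopologicalSpace.SeparableSpace Y] [AddCommGroup W] [Module 𝕜 W]
    (B : W →ₗ[𝕜] Module.Dual 𝕜 Y) (hB : Function.Injective B)
    (g : ℕ → W) (hg : LinearIndependent 𝕜 g) :
    ∃ (x : ℕ → Y) (h : ℕ → W), (∀ n, h n ∈ Submodule.span 𝕜 (Set.range g)) ∧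
      (∀ n, B (h n) (x n) = 1) ∧ (∀ m n, m ≠ n → B (h m) (x n) = 0) ∧
      Dense (Submodule.span 𝕜 (Set.range x) : Set Y) := by
  obtain ⟨V, hV, hVadd⟩ := IsTopologicalAddGroup.exists_antitone_basis_nhds_zero Y
  -- Unpairing makes each term of the dense sequence occur together with each basic neighbourhood.
  let y : ℕ → Y := fun n => TopologicalSpace.denseSeq Y n.unpair.1
  obtain ⟨x, h, h1, h2, h3, h4⟩ := exists_biorthogonal_of_linearIndependent B hB
    (fun n => V n.unpair.2) (fun n => hV.1.mem_of_mem trivial) y g hg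
  refine ⟨x, h, h1, h2, h3, fun z => mem_closure_iff_nhds.2 fun O hO => ?_⟩
  have hO' : (fun v => z + v) ⁻¹' O ∈ 𝓝 (0 : Y) :=
    (continuous_const_add z).continuousAt.preimage_mem_nhds (by simpa using hO)
  obtain ⟨m, -, hm⟩ := hV.1.mem_iff.1 hO'
  have hz : (fun v => v - z) ⁻¹' V (m + 1) ∈ 𝓝 z :=
    (continuous_sub_right z).continuousAt.preimage_mem_nhds
      (by rw [sub_self]; exact hV.1.mem_of_mem trivial)
  obtain ⟨_, hv, i, rfl⟩ := mem_closure_iff_nhds.1 (TopologicalSpace.denseRange_denseSeq Y z) _ hz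
  obtain ⟨y', hy', hy''⟩ := h4 (Nat.pair i (m + 1))
  refine ⟨y', ?_, hy'⟩
  simp only [y, Nat.unpair_pair] at hy''
  have := hm (hVadd m (Set.add_mem_add hv hy''))
  simpa using this

end BiorthogonalSequences

/-! ### Convergent series in complete spaces. -/

section SeriesInFSpaces

open scoped Pointwise

/-- Finite sums of terms taken from rapidly decreasing neighbourhoods are small. -/
theorem sum_mem_of_add_subset {Y : Type*} [AddCommMonoid Y] {V : ℕ → Set Y} (hanti : Antitone V)
    (h0 : ∀ n, (0 : Y) ∈ V n) (hadd : ∀ n, V (n + 1) + V (n + 1) ⊆ V n) {t : ℕ → Y}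
    (ht : ∀ n, t n ∈ V n) (s : Finset ℕ) (m : ℕ) (hs : ∀ i ∈ s, m < i) :
    ∑ i ∈ s, t i ∈ V m := by
  induction s using Finset.induction_on_min generalizing m with
  | empty => simpa using h0 m
  | insert a s ha ih =>
    have hma : m + 1 ≤ a := hs a (Finset.mem_insert_self a s)
    rw [Finset.sum_insert fun h => lt_irrefl _ (ha a h)]
    -- The term of least index `a ≥ m + 1` and the sum of the others, in `V a` by induction, both
    -- lie in `V (m + 1)`.
    exact hadd m (Set.add_mem_add (hanti hma (ht a)) (hanti hma (ih a ha)))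

/-- In a complete first countable topological vector space every sequence can be rescaled so as
to be the image of the unit vectors under a continuous operator. -/
theorem exists_continuousLinearMap_hasSum {𝕜 Y E : Type*} [RCLike 𝕜] [AddCommGroup Y]
    [Module 𝕜 Y] [UniformSpace Y] [IsUniformAddGroup Y] [ContinuousSMul 𝕜 Y]
    [FirstCountableTopology Y] [CompleteSpace Y] [T2Space Y]
    [NormedAddCommGroup E] [NormedSpace 𝕜 E]
    (φ : ℕ → E →L[𝕜] 𝕜) (hφ : ∀ n a, ‖φ n a‖ ≤ ‖a‖) (x : ℕ → Y) :
    ∃ r : ℕ → 𝕜, (∀ n, r n ≠ 0) ∧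
      ∃ J : E →L[𝕜] Y, ∀ a, HasSum (fun n => φ n a • r n • x n) (J a) := by
  obtain ⟨V, hV, hadd⟩ := IsTopologicalAddGroup.exists_antitone_basis_nhds_zero Y
  have hV0 : ∀ n, (0 : Y) ∈ V n := fun n => mem_of_mem_nhds (hV.1.mem_of_mem trivial)
  have hr : ∀ n, ∃ r : 𝕜, r ≠ 0 ∧ ∀ c : 𝕜, ‖c‖ ≤ 1 → c • r • x n ∈ V n := by
    intro n
    have ht : (fun c : 𝕜 => c • x n) ⁻¹' V n ∈ 𝓝 (0 : 𝕜) :=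
      (continuous_id.smul continuous_const).continuousAt.preimage_mem_nhds
        (by simpa using hV.1.mem_of_mem trivial)
    obtain ⟨δ, hδ, hδV⟩ := Metric.mem_nhds_iff.1 ht
    refine ⟨((δ / 2 : ℝ) : 𝕜), by simpa using hδ.ne', fun c hc => ?_⟩
    rw [smul_smul]
    refine hδV (mem_ball_zero_iff.2 ?_)
    rw [norm_mul, RCLike.norm_ofReal, abs_of_pos (half_pos hδ)]
    nlinarith [norm_nonneg c]
  choose r hr0 hr using hr
  refine ⟨r, hr0, ?_⟩
  have hterm : ∀ a : E, ‖a‖ ≤ 1 → ∀ n, φ n a • r n • x n ∈ V n := fun a ha n =>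
    hr n _ ((hφ n a).trans ha)
  have hball : ∀ a : E, ‖a‖ ≤ 1 → Summable fun n => φ n a • r n • x n := by
    intro a ha
    refine summable_iff_vanishing.2 fun O hO => ?_
    obtain ⟨m, -, hm⟩ := hV.1.mem_iff.1 hO
    refine ⟨Finset.range (m + 1), fun s hs => hm ?_⟩
    refine sum_mem_of_add_subset hV.2 hV0 hadd (hterm a ha) s m fun i hi => ?_
    by_contra! hle
    exact Finset.disjoint_left.1 hs hi (Finset.mem_range.2 (by omega))
  have hsummable : ∀ a : E, Summable fun n => φ n a • r n • x n := by
    intro a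
    have hc : ((‖a‖ + 1 : ℝ) : 𝕜) ≠ 0 := by
      rw [Ne, RCLike.ofReal_eq_zero]
      positivity
    have h := (hball (((‖a‖ + 1 : ℝ) : 𝕜)⁻¹ • a) (by
      rw [norm_smul, norm_inv, RCLike.norm_ofReal, abs_of_pos (by positivity)]
      rw [inv_mul_le_iff₀ (by positivity)]
      linarith)).const_smul ((‖a‖ + 1 : ℝ) : 𝕜)
    refine h.congr fun n => ?_
    rw [map_smul, smul_assoc, smul_inv_smul₀ hc]
  let J₀ : E →ₗ[𝕜] Y :=
    { toFun := fun a => ∑' n, φ n a • r n • x n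
      map_add' := fun a b => by
        rw [← (hsummable a).tsum_add (hsummable b)]
        simp only [map_add, add_smul]
      map_smul' := fun c a => by
        rw [RingHom.id_apply, ← (hsummable a).tsum_const_smul c]
        simp only [map_smul, smul_assoc] }
  have hcont : Continuous J₀ := by
    refine continuous_of_continuousAt_zero J₀ ?_
    rw [ContinuousAt, map_zero]
    intro O hO
    -- A closed neighbourhood lets membership pass from partial sums to the limit. The first `m + 2`
    -- terms are small by continuity, the tail uniformly on the unit ball.
    obtain ⟨O', ⟨hO', hcl⟩, (hO'O : O' ⊆ O)⟩ := (closed_nhds_basis (0 : Y)).mem_iff.1 hO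
    obtain ⟨m, -, hm⟩ := hV.1.mem_iff.1 hO'
    have hfin : Tendsto (fun a : E => ∑ n ∈ Finset.range (m + 2), φ n a • r n • x n) (𝓝 0)
        (𝓝 0) := by
      have hc : Continuous fun a : E => ∑ n ∈ Finset.range (m + 2), φ n a • r n • x n :=
        continuous_finsetSum _ fun n _ => (φ n).continuous.smul continuous_const
      have := hc.tendsto 0
      simpa using this
    rw [mem_map]
    filter_upwards [hfin.eventually (hV.1.mem_of_mem (i := m + 1) trivial),
      Metric.closedBall_mem_nhds (0 : E) one_pos] with a ha hball1
    rw [mem_closedBall_zero_iff] at hball1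
    refine hO'O (hcl.mem_of_tendsto (hsummable a).hasSum.tendsto_sum_nat ?_)
    filter_upwards [eventually_ge_atTop (m + 2)] with N hN
    rw [← Finset.sum_range_add_sum_Ico _ hN]
    refine hm (hadd m (Set.add_mem_add ha ?_))
    exact sum_mem_of_add_subset hV.2 hV0 hadd (hterm a hball1) _ _ fun i hi =>
      (Finset.mem_Ico.1 hi).1
  exact ⟨⟨J₀, hcont⟩, fun a => (hsummable a).hasSum⟩

end SeriesInFSpaces

/-! ### Exponentials of operators factored through a Banach space. -/

section FactoredGroups

variable {𝕜 ι X E : Type*} [RCLike 𝕜] [Fintype ι] [AddCommGroup X] [Module 𝕜 X]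
  [TopologicalSpace X] [NormedAddCommGroup E] [NormedSpace 𝕜 E]

/-- For operators `B i` on `E` and `G : X → E`, `J : E → X`, the operator
`(e, f) ↦ (∑ i, z i • B i (G (J e) + f), 0)` on `E × E`. -/
noncomputable def blockGenerator (G : X →L[𝕜] E) (J : E →L[𝕜] X) (B : ι → E →L[𝕜] E) :
    (ι → 𝕜) →L[𝕜] ((E × E) →L[𝕜] (E × E)) :=
  ∑ i, (ContinuousLinearMap.proj i : (ι → 𝕜) →L[𝕜] 𝕜).smulRight
    ((ContinuousLinearMap.inl 𝕜 E E).comp ((B i).comp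
      ((G.comp J).comp (ContinuousLinearMap.fst 𝕜 E E) + ContinuousLinearMap.snd 𝕜 E E)))

theorem blockGenerator_apply (G : X →L[𝕜] E) (J : E →L[𝕜] X) (B : ι → E →L[𝕜] E) (z : ι → 𝕜)
    (v : E × E) :
    blockGenerator G J B z v = (∑ i, z i • B i (G (J v.1) + v.2), 0) := by
  simp only [blockGenerator, FunLike.coe_sum, Finset.sum_apply,
    ContinuousLinearMap.smulRight_apply, FunLike.coe_smul, Pi.smul_apply]
  ext
  · simp [Prod.fst_sum]
  · simp [Prod.snd_sum]

/-- The products contain `B i ∘ G ∘ J ∘ B j` applied to `G (J e) + f` with `f` arbitrary, so the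
hypothesis compares these operators without a trailing `G ∘ J`. -/
theorem commute_blockGenerator (G : X →L[𝕜] E) (J : E →L[𝕜] X) (B : ι → E →L[𝕜] E)
    (hB : ∀ i j a, B i (G (J (B j a))) = B j (G (J (B i a)))) (z w : ι → 𝕜) :
    Commute (blockGenerator G J B z) (blockGenerator G J B w) := by
  refine ContinuousLinearMap.ext fun v => ?_
  rw [mul_apply_eq_comp, mul_apply_eq_comp]
  simp only [blockGenerator_apply, map_sum, map_smul, add_zero, Finset.smul_sum]
  rw [Finset.sum_comm]
  congr 1
  refine Finset.sum_congr rfl fun i _ => Finset.sum_congr rfl fun j _ => ?_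
  rw [hB, smul_comm]

/-- The operator `exp (∑ i, z i • B i ∘ G ∘ J)` on `E`. -/
noncomputable def factoredExpLift (G : X →L[𝕜] E) (J : E →L[𝕜] X) (B : ι → E →L[𝕜] E)
    (z : ι → 𝕜) : E →L[𝕜] E :=
  (ContinuousLinearMap.fst 𝕜 E E).comp
    ((NormedSpace.exp (blockGenerator G J B z)).comp (ContinuousLinearMap.inl 𝕜 E E))

/-- The operator `exp (∑ i, z i • J ∘ B i ∘ G)` on `X`. -/
noncomputable def factoredExp [IsTopologicalAddGroup X] (G : X →L[𝕜] E)
    (J : E →L[𝕜] X) (B : ι → E →L[𝕜] E)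
    (z : ι → 𝕜) : X →L[𝕜] X :=
  ContinuousLinearMap.id 𝕜 X + J.comp ((ContinuousLinearMap.fst 𝕜 E E).comp
    ((NormedSpace.exp (blockGenerator G J B z)).comp ((ContinuousLinearMap.inr 𝕜 E E).comp G)))

theorem factoredExp_apply [IsTopologicalAddGroup X] (G : X →L[𝕜] E)
    (J : E →L[𝕜] X) (B : ι → E →L[𝕜] E)
    (z : ι → 𝕜) (x : X) : factoredExp G J B z x =
      x + J (NormedSpace.exp (blockGenerator G J B z) (0, G x)).1 := rfl

theorem factoredExp_zero [IsTopologicalAddGroup X] (G : X →L[𝕜] E)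
    (J : E →L[𝕜] X) (B : ι → E →L[𝕜] E) :
    factoredExp G J B 0 = ContinuousLinearMap.id 𝕜 X := by
  refine ContinuousLinearMap.ext fun x => ?_
  rw [factoredExp_apply, map_zero, NormedSpace.exp_zero]
  simp

variable [CompleteSpace E]

theorem hasSum_exp_clm_apply {F : Type*} [NormedAddCommGroup F] [NormedSpace 𝕜 F]
    [CompleteSpace F] (K : F →L[𝕜] F) (v : F) :
    HasSum (fun m : ℕ => ((m.factorial : 𝕜)⁻¹) • (K ^ m) v) (NormedSpace.exp K v) := by
  have h := NormedSpace.exp_series_hasSum_exp' (𝕂 := 𝕜) K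
  exact h.mapL (ContinuousLinearMap.apply 𝕜 F v)

theorem exp_clm_add {F : Type*} [NormedAddCommGroup F] [NormedSpace 𝕜 F]
    [CompleteSpace F] {K L : F →L[𝕜] F} (h : Commute K L) :
    NormedSpace.exp (K + L) = NormedSpace.exp K * NormedSpace.exp L := by
  let : NormedAlgebra ℚ (F →L[𝕜] F) := NormedAlgebra.restrictScalars ℚ 𝕜 _
  exact NormedSpace.exp_add_of_commute h

theorem exp_clm_apply_of_apply_eq_zero {F : Type*} [NormedAddCommGroup F] [NormedSpace 𝕜 F]
    [CompleteSpace F] {K : F →L[𝕜] F} {v : F} (h : K v = 0) : NormedSpace.exp K v = v := by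
  refine (hasSum_exp_clm_apply K v).unique ?_
  have := hasSum_single (f := fun m : ℕ => ((m.factorial : 𝕜)⁻¹) • (K ^ m) v) 0 (fun m hm => by
    obtain ⟨n, rfl⟩ := Nat.exists_eq_succ_of_ne_zero hm
    rw [pow_succ, mul_apply_eq_comp, h, map_zero, smul_zero])
  simpa using this

theorem continuous_exp_clm {F : Type*} [NormedAddCommGroup F] [NormedSpace 𝕜 F]
    [CompleteSpace F] : Continuous (NormedSpace.exp : (F →L[𝕜] F) → (F →L[𝕜] F)) := by
  let : NormedAlgebra ℚ (F →L[𝕜] F) := NormedAlgebra.restrictScalars ℚ 𝕜 _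
  exact NormedSpace.exp_continuous

/-- The vector `(a, -G (J a))` is in the kernel of the generator, hence fixed by its exponential. -/
theorem exp_blockGenerator_apply_eq (G : X →L[𝕜] E) (J : E →L[𝕜] X) (B : ι → E →L[𝕜] E)
    (z : ι → 𝕜) (a f : E) :
    NormedSpace.exp (blockGenerator G J B z) (a, f) =
      NormedSpace.exp (blockGenerator G J B z) (0, f + G (J a)) + (a, - G (J a)) := by
  have h : blockGenerator G J B z (a, - G (J a)) = 0 := by
    simp [blockGenerator_apply]
  have e : (a, f) = (0, f + G (J a)) + (a, - G (J a)) := by simp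
  rw [e, map_add, exp_clm_apply_of_apply_eq_zero h]

/-- If `P` intertwines the directional derivatives with the generators, then it intertwines
translations with the group. -/
theorem factoredExpLift_apply_eq_translatePoly (G : X →L[𝕜] E) (J : E →L[𝕜] X)
    (B : ι → E →L[𝕜] E) (P : MvPolynomial ι 𝕜 →ₗ[𝕜] E)
    (hP : ∀ i p, B i (G (J (P p))) = P (MvPolynomial.pderiv i p)) (z : ι → 𝕜)
    (p : MvPolynomial ι 𝕜) :
    factoredExpLift G J B z (P p) = P (translatePoly z p) := by
  have hpow : ∀ m : ℕ, (blockGenerator G J B z ^ m) (P p, 0) =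
      (P ((directionalDeriv z)^[m] p), 0) := by
    intro m
    induction m with
    | zero => rfl
    | succ m ih =>
      rw [pow_succ', mul_apply_eq_comp, ih, blockGenerator_apply,
        Function.iterate_succ_apply', directionalDeriv_eq_sum, map_sum]
      simp only [add_zero, hP, map_smul]
  have h := (hasSum_exp_clm_apply (blockGenerator G J B z) (P p, 0)).mapL
    (ContinuousLinearMap.fst 𝕜 E E)
  refine h.unique ?_
  convert hasSum_directionalDeriv z p P using 2 with m
  rw [map_smul, hpow]
  rfl

variable [IsTopologicalAddGroup X]

theorem factoredExp_comp (G : X →L[𝕜] E) (J : E →L[𝕜] X) (B : ι → E →L[𝕜] E)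
    (z : ι → 𝕜) (a : E) : factoredExp G J B z (J a) = J (factoredExpLift G J B z a) := by
  rw [factoredExp_apply]
  change _ = J (NormedSpace.exp (blockGenerator G J B z) (a, 0)).1
  rw [exp_blockGenerator_apply_eq G J B z a 0, zero_add, Prod.fst_add, map_add, add_comm]

theorem factoredExp_add (G : X →L[𝕜] E) (J : E →L[𝕜] X) (B : ι → E →L[𝕜] E)
    (hB : ∀ i j a, B i (G (J (B j a))) = B j (G (J (B i a)))) (s t : ι → 𝕜) :
    factoredExp G J B (s + t) = (factoredExp G J B t).comp (factoredExp G J B s) := by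
  refine ContinuousLinearMap.ext fun x => ?_
  -- The generator has range in `E × 0`, so its exponential preserves the second coordinate.
  have hsnd : (NormedSpace.exp (blockGenerator G J B s) (0, G x)).2 = G x := by
    have h1 := (hasSum_exp_clm_apply (blockGenerator G J B s) (0, G x)).mapL
      (ContinuousLinearMap.snd 𝕜 E E)
    refine h1.unique ?_
    have := hasSum_single (f := fun m : ℕ => (ContinuousLinearMap.snd 𝕜 E E)
      (((m.factorial : 𝕜)⁻¹) • (blockGenerator G J B s ^ m) (0, G x))) 0 (fun m hm => by
      obtain ⟨n, rfl⟩ := Nat.exists_eq_succ_of_ne_zero hm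
      rw [pow_succ', mul_apply_eq_comp, blockGenerator_apply, map_smul]
      exact smul_zero _)
    simpa using this
  set a := (NormedSpace.exp (blockGenerator G J B s) (0, G x)).1 with ha
  have hs : NormedSpace.exp (blockGenerator G J B s) (0, G x) = (a, G x) := Prod.ext rfl hsnd
  rw [ContinuousLinearMap.comp_apply, factoredExp_apply, factoredExp_apply, factoredExp_apply,
    map_add (blockGenerator G J B), add_comm (blockGenerator G J B s),
    exp_clm_add (commute_blockGenerator G J B hB t s), mul_apply_eq_comp, hs,
    exp_blockGenerator_apply_eq, map_add G, Prod.fst_add, map_add J]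
  dsimp only
  abel

theorem exists_nhds_tendstoUniformly_factoredExp (G : X →L[𝕜] E) (J : E →L[𝕜] X)
    (B : ι → E →L[𝕜] E) : ∃ U ∈ 𝓝 (0 : X), ∀ (t : ℕ → ι → 𝕜) (a : ι → 𝕜),
      Tendsto t atTop (𝓝 a) → ∀ W ∈ 𝓝 (0 : X), ∀ᶠ n in atTop, ∀ x ∈ U,
        factoredExp G J B (t n) x - factoredExp G J B a x ∈ W := by
  -- On this neighbourhood the vectors `(0, G x)` have norm at most one, so norm convergence of the
  -- exponentials is uniform there.
  refine ⟨G ⁻¹' Metric.closedBall 0 1, G.continuous.continuousAt.preimage_mem_nhds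
    (by rw [map_zero]; exact Metric.closedBall_mem_nhds _ one_pos), fun t a hta W hW => ?_⟩
  have hJW : J ⁻¹' W ∈ 𝓝 (0 : E) :=
    J.continuous.continuousAt.preimage_mem_nhds (by rwa [map_zero])
  obtain ⟨δ, hδ, hδW⟩ := Metric.mem_nhds_iff.1 hJW
  have hlim : Tendsto (fun n => ‖NormedSpace.exp (blockGenerator G J B (t n)) -
      NormedSpace.exp (blockGenerator G J B a)‖) atTop (𝓝 0) := by
    rw [← tendsto_iff_norm_sub_tendsto_zero]
    exact ((continuous_exp_clm.comp (blockGenerator G J B).continuous).tendsto a).comp hta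
  filter_upwards [hlim.eventually_lt_const hδ] with n hn x hx
  rw [factoredExp_apply, factoredExp_apply, add_sub_add_left_eq_sub, ← map_sub]
  refine hδW (mem_ball_zero_iff.2 (lt_of_le_of_lt ?_ hn))
  rw [← Prod.fst_sub, ← sub_apply]
  refine (norm_fst_le _).trans ((ContinuousLinearMap.le_opNorm _ _).trans ?_)
  refine mul_le_of_le_one_right (norm_nonneg _) ?_
  rw [Prod.norm_mk, norm_zero]
  exact max_le zero_le_one (mem_closedBall_zero_iff.1 hx)

theorem analyticAt_factoredExp (G : X →L[𝕜] E) (J : E →L[𝕜] X)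
    (B : ι → E →L[𝕜] E) (x : X) (f : X →L[𝕜] 𝕜) (z : ι → 𝕜) :
    AnalyticAt 𝕜 (fun w => f (factoredExp G J B w x)) z := by
  let Λ : ((E × E) →L[𝕜] (E × E)) →L[𝕜] 𝕜 :=
    ((f.comp J).comp (ContinuousLinearMap.fst 𝕜 E E)).comp
      (ContinuousLinearMap.apply 𝕜 (E × E) (0, G x))
  have h : (fun w => f (factoredExp G J B w x)) =
      fun w => f x + Λ (NormedSpace.exp (blockGenerator G J B w)) := by
    funext w
    rw [factoredExp_apply, map_add]
    rfl
  rw [h]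
  refine analyticAt_const.add ?_
  exact (Λ.analyticAt _).comp ((NormedSpace.exp_analytic (𝕂 := 𝕜) _).comp
    ((blockGenerator G J B).analyticAt z))

end FactoredGroups

/-! ### Weighted shifts on `ℓ¹` and the embedding of polynomials. -/

section SummableSequences

variable {𝕜 : Type*} [RCLike 𝕜]

/-- Functionals dominated near zero by a summable family are the coordinates of a continuous
operator into `ℓ¹`. -/
theorem exists_clm_lp_one {ι Z : Type*} [AddCommGroup Z] [Module 𝕜 Z] [TopologicalSpace Z]
    [IsTopologicalAddGroup Z] [ContinuousSMul 𝕜 Z] (φ : ι → Z →L[𝕜] 𝕜) {U : Set Z}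
    (hU : U ∈ 𝓝 (0 : Z)) {c : ι → ℝ} (hc : Summable c) (hφ : ∀ i, ∀ x ∈ U, ‖φ i x‖ ≤ c i) :
    ∃ Φ : Z →L[𝕜] lp (fun _ : ι => 𝕜) 1, ∀ x i, Φ x i = φ i x := by
  have hsumm : ∀ x : Z, Summable fun i => ‖φ i x‖ := by
    intro x
    have ht : (fun a : 𝕜 => a • x) ⁻¹' U ∈ 𝓝[≠] (0 : 𝕜) :=
      mem_nhdsWithin_of_mem_nhds
        ((continuous_id.smul continuous_const).continuousAt.preimage_mem_nhds (by simpa using hU))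
    obtain ⟨a, haU, ha⟩ := (inter_mem ht self_mem_nhdsWithin : _ ∈ 𝓝[≠] (0 : 𝕜)) |>
      (NormedField.nhdsNE_neBot (0 : 𝕜)).nonempty_of_mem
    have h : Summable fun i => ‖φ i (a • x)‖ :=
      Summable.of_nonneg_of_le (fun i => norm_nonneg _) (fun i => hφ i _ haU) hc
    simp only [map_smul, smul_eq_mul, norm_mul] at h
    exact (summable_mul_left_iff (norm_ne_zero_iff.2 ha)).1 h
  have hmem : ∀ x : Z, Memℓp (fun i => φ i x) 1 := fun x =>
    memℓp_gen (by simpa using hsumm x)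
  let Φ₀ : Z →ₗ[𝕜] lp (fun _ : ι => 𝕜) 1 :=
    { toFun := fun x => ⟨fun i => φ i x, hmem x⟩
      map_add' := fun x y => by
        ext i
        exact map_add (φ i) x y
      map_smul' := fun a x => by
        ext i
        exact map_smul (φ i) a x }
  have hbdd : ∃ V ∈ 𝓝 (0 : Z), Bornology.IsVonNBounded 𝕜 (Φ₀ '' V) := by
    refine ⟨U, hU, (NormedSpace.isVonNBounded_iff' 𝕜).2 ⟨∑' i, c i, ?_⟩⟩
    rintro _ ⟨x, hx, rfl⟩
    rw [lp.norm_eq_tsum_rpow (by simp)]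
    simp only [ENNReal.toReal_one, Real.rpow_one, div_one]
    exact (hsumm x).tsum_le_tsum (fun i => hφ i x hx) hc
  exact ⟨Φ₀.clmOfExistsBoundedImage hbdd, fun x i => rfl⟩

theorem lp_one_hasSum_single {ι : Type*} [DecidableEq ι] (a : lp (fun _ : ι => 𝕜) 1) :
    HasSum (fun i => lp.single 1 i (a i)) a :=
  lp.hasSum_single (by simp) a

/-- The coordinate functionals on `ℓ¹`. -/
noncomputable def lpOneCoord (ι : Type*) (i : ι) : lp (fun _ : ι => 𝕜) 1 →L[𝕜] 𝕜 :=
  LinearMap.mkContinuous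
    { toFun := fun a => a i
      map_add' := fun _ _ => rfl
      map_smul' := fun _ _ => rfl } 1
    (fun a => by rw [one_mul]; exact lp.norm_apply_le_norm one_ne_zero a i)

theorem lpOneCoord_apply (ι : Type*) (i : ι) (a : lp (fun _ : ι => 𝕜) 1) :
    lpOneCoord ι i a = a i := rfl

/-- For every family `d` of nonzero scalars there are weights making the generalized backward
shifts with these weights continuous on `ℓ¹`, and their composition with the diagonal operator
defined by `d` conjugate to the unweighted backward shifts. -/
theorem exists_weighted_backward_shifts {ι : Type*} [Finite ι] [DecidableEq ι]
    (d : (ι →₀ ℕ) → 𝕜) (hd : ∀ α, d α ≠ 0) :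
    ∃ s : (ι →₀ ℕ) → 𝕜, (∀ α, s α ≠ 0) ∧
      ∃ B : ι → lp (fun _ : ι →₀ ℕ => 𝕜) 1 →L[𝕜] lp (fun _ : ι →₀ ℕ => 𝕜) 1,
        ∀ i a α, B i a α = s α * (s (α + Finsupp.single i 1) * d (α + Finsupp.single i 1))⁻¹
          * a (α + Finsupp.single i 1) := by
  obtain ⟨e, he⟩ := exists_injective_nat (ι →₀ ℕ)
  -- Passing from `α` to `β = α + eᵢ` multiplies `s` by at least `c β`, so the shift weight is at
  -- most `1 / (c β * ‖d β‖) ≤ 2 ^ (-e β)`, which is summable.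
  let c : (ι →₀ ℕ) → ℝ := fun α => 1 + 2 ^ e α / ‖d α‖
  have hc : ∀ α, 1 ≤ c α := fun α => by
    simp only [c]
    have : 0 ≤ 2 ^ e α / ‖d α‖ := by positivity
    linarith
  let s : (ι →₀ ℕ) → ℝ := fun α => ∏ γ ∈ Finset.Iic α, c γ
  have hs : ∀ α, 0 < s α := fun α => Finset.prod_pos fun γ _ => one_pos.trans_le (hc γ)
  have hstep : ∀ (α : ι →₀ ℕ) (i : ι),
      s α * c (α + Finsupp.single i 1) ≤ s (α + Finsupp.single i 1) := by
    intro α i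
    have hlt : α < α + Finsupp.single i 1 := by
      refine lt_of_le_of_ne le_self_add fun h => ?_
      have := DFunLike.congr_fun h i
      simp at this
    have hnot : α + Finsupp.single i 1 ∉ Finset.Iic α := fun h =>
      absurd (Finset.mem_Iic.1 h) (not_le_of_gt hlt)
    rw [mul_comm]
    simp only [s]
    rw [← Finset.prod_insert hnot]
    refine Finset.prod_le_prod_of_subset_of_one_le (fun γ hγ => ?_)
      (fun γ _ => zero_le_one.trans (hc γ)) (fun γ _ _ => hc γ)
    rcases Finset.mem_insert.1 hγ with rfl | h
    · exact Finset.mem_Iic.2 le_rfl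
    · exact Finset.mem_Iic.2 ((Finset.mem_Iic.1 h).trans hlt.le)
  have hweight : ∀ (α : ι →₀ ℕ) (i : ι),
      ‖((s α : ℝ) : 𝕜) * (((s (α + Finsupp.single i 1) : ℝ) : 𝕜) * d (α + Finsupp.single i 1))⁻¹‖
        ≤ (1 / 2 : ℝ) ^ e (α + Finsupp.single i 1) := by
    intro α i
    set β := α + Finsupp.single i 1 with hβ
    have hdβ : 0 < ‖d β‖ := norm_pos_iff.2 (hd β)
    rw [norm_mul, norm_inv, norm_mul, RCLike.norm_ofReal, RCLike.norm_ofReal, abs_of_pos (hs _),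
      abs_of_pos (hs _), one_div, inv_pow, ← div_eq_mul_inv,
      div_le_iff₀ (mul_pos (hs _) hdβ), inv_mul_eq_div, le_div_iff₀ (by positivity)]
    have h1 := hstep α i
    rw [← hβ] at h1
    have h2 : 2 ^ e β / ‖d β‖ ≤ c β := by simp only [c]; linarith
    calc s α * 2 ^ e β = s α * (2 ^ e β / ‖d β‖) * ‖d β‖ := by field_simp
      _ ≤ s α * c β * ‖d β‖ := by
        gcongr
      _ ≤ s β * ‖d β‖ := by gcongr
  refine ⟨fun α => (s α : 𝕜), fun α => RCLike.ofReal_ne_zero.2 (hs α).ne', ?_⟩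
  have hB : ∀ i : ι, ∃ B : lp (fun _ : ι →₀ ℕ => 𝕜) 1 →L[𝕜] lp (fun _ : ι →₀ ℕ => 𝕜) 1,
      ∀ a α, B a α = (s α : 𝕜) * ((s (α + Finsupp.single i 1) : 𝕜) *
        d (α + Finsupp.single i 1))⁻¹ * a (α + Finsupp.single i 1) := by
    intro i
    have hsum : Summable fun α : ι →₀ ℕ => (1 / 2 : ℝ) ^ e (α + Finsupp.single i 1) :=
      summable_geometric_two.comp_injective (he.comp (add_left_injective (Finsupp.single i 1)))
    refine exists_clm_lp_one (Z := lp (fun _ : ι →₀ ℕ => 𝕜) 1)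
      (fun α => ((s α : 𝕜) * ((s (α + Finsupp.single i 1) : 𝕜) *
        d (α + Finsupp.single i 1))⁻¹) • lpOneCoord (𝕜 := 𝕜) _ (α + Finsupp.single i 1))
      (Metric.closedBall_mem_nhds 0 one_pos) hsum fun α x hx => ?_
    rw [FunLike.coe_smul, Pi.smul_apply, lpOneCoord_apply, norm_smul]
    refine (mul_le_of_le_one_right (norm_nonneg _) ?_).trans (hweight α i)
    exact (lp.norm_apply_le_norm one_ne_zero x _).trans (mem_closedBall_zero_iff.1 hx)
  choose B hB using hB
  exact ⟨B, hB⟩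

/-- The linear map `MvPolynomial ι 𝕜 → ℓ¹` sending the monomial of exponent `α` to
`α! s(α)` times the unit vector at `α`. -/
noncomputable def polyToLp {ι : Type*} [Fintype ι] [DecidableEq ι] (s : (ι →₀ ℕ) → 𝕜) :
    MvPolynomial ι 𝕜 →ₗ[𝕜] lp (fun _ : ι →₀ ℕ => 𝕜) 1 :=
  (MvPolynomial.basisMonomials ι 𝕜).constr 𝕜 fun α =>
    lp.single 1 α ((∏ i, ((α i).factorial : 𝕜)) * s α)

theorem polyToLp_monomial {ι : Type*} [Fintype ι] [DecidableEq ι] (s : (ι →₀ ℕ) → 𝕜)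
    (α : ι →₀ ℕ) (c : 𝕜) :
    polyToLp s (MvPolynomial.monomial α c) =
      lp.single 1 α (c * ((∏ i, ((α i).factorial : 𝕜)) * s α)) := by
  have h : MvPolynomial.monomial α c = c • MvPolynomial.monomial α (1 : 𝕜) := by
    rw [MvPolynomial.smul_monomial, smul_eq_mul, mul_one]
  have h1 := (MvPolynomial.basisMonomials ι 𝕜).constr_basis 𝕜 (fun α =>
    (lp.single 1 α ((∏ i, ((α i).factorial : 𝕜)) * s α) : lp (fun _ : ι →₀ ℕ => 𝕜) 1)) α
  rw [MvPolynomial.coe_basisMonomials] at h1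
  rw [h, map_smul, ← smul_eq_mul c, lp.single_smul]
  exact congrArg _ h1

/-- Monomials go to nonzero multiples of unit vectors, so the range contains all finitely supported
sequences. -/
theorem denseRange_polyToLp {ι : Type*} [Fintype ι] [DecidableEq ι] {s : (ι →₀ ℕ) → 𝕜}
    (hs : ∀ α, s α ≠ 0) : DenseRange (polyToLp s) := by
  intro a
  refine mem_closure_of_tendsto (lp_one_hasSum_single a) (Eventually.of_forall fun F => ?_)
  refine Submodule.sum_mem (LinearMap.range (polyToLp s)) fun α _ => ?_
  have hα : (∏ i, ((α i).factorial : 𝕜)) * s α ≠ 0 :=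
    mul_ne_zero (Finset.prod_ne_zero_iff.2 fun i _ => Nat.cast_ne_zero.2 (Nat.factorial_ne_zero _))
      (hs α)
  refine ⟨MvPolynomial.monomial α (a α * ((∏ i, ((α i).factorial : 𝕜)) * s α)⁻¹), ?_⟩
  rw [polyToLp_monomial, inv_mul_cancel_right₀ hα]

theorem prod_factorial_add_single {ι : Type*} [Fintype ι] [DecidableEq ι] (β : ι →₀ ℕ) (i : ι) :
    ∏ j, (((β + Finsupp.single i 1 : ι →₀ ℕ) j).factorial : 𝕜) =
      ((β i + 1 : ℕ) : 𝕜) * ∏ j, ((β j).factorial : 𝕜) := by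
  rw [← Finset.mul_prod_erase Finset.univ _ (Finset.mem_univ i),
    ← Finset.mul_prod_erase Finset.univ (fun j => ((β j).factorial : 𝕜)) (Finset.mem_univ i),
    ← mul_assoc]
  congr 1
  · rw [Finsupp.add_apply, Finsupp.single_eq_same, Nat.factorial_succ, Nat.cast_mul]
  · refine Finset.prod_congr rfl fun j hj => ?_
    rw [Finsupp.add_apply, Finsupp.single_eq_of_ne (Finset.ne_of_mem_erase hj), add_zero]

/-- `polyToLp` intertwines partial derivatives with weighted backward shifts. -/
theorem shift_polyToLp {ι : Type*} [Fintype ι] [DecidableEq ι] {s d : (ι →₀ ℕ) → 𝕜}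
    (hs : ∀ α, s α ≠ 0) (hd : ∀ α, d α ≠ 0) (i : ι)
    (N : lp (fun _ : ι →₀ ℕ => 𝕜) 1 →ₗ[𝕜] lp (fun _ : ι →₀ ℕ => 𝕜) 1)
    (hN : ∀ a α, N a α = s α * (s (α + Finsupp.single i 1) * d (α + Finsupp.single i 1))⁻¹
      * (d (α + Finsupp.single i 1) * a (α + Finsupp.single i 1))) (p : MvPolynomial ι 𝕜) :
    N (polyToLp s p) = polyToLp s (MvPolynomial.pderiv i p) := by
  induction p using MvPolynomial.induction_on' with
  | add p q hp hq => rw [map_add, map_add, map_add, map_add, hp, hq]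
  | monomial α c =>
    rw [MvPolynomial.pderiv_monomial, polyToLp_monomial, polyToLp_monomial]
    ext γ
    rw [hN, lp.single_apply, lp.single_apply]
    by_cases hα : α i = 0
    · have hne : γ + Finsupp.single i 1 ≠ α := by
        rintro rfl
        simp at hα
      rw [Pi.single_eq_of_ne hne, hα]
      simp
    · obtain ⟨β, rfl⟩ : ∃ β, α = β + Finsupp.single i 1 :=
        ⟨α - Finsupp.single i 1, (tsub_add_cancel_of_le
          (Finsupp.single_le_iff.2 (Nat.one_le_iff_ne_zero.2 hα))).symm⟩
      rw [add_tsub_cancel_right]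
      by_cases hγ : γ = β
      · subst hγ
        rw [Pi.single_eq_same, Pi.single_eq_same, prod_factorial_add_single, Finsupp.add_apply,
          Finsupp.single_eq_same]
        have h1 := hs (γ + Finsupp.single i 1)
        have h2 := hd (γ + Finsupp.single i 1)
        field_simp
      · rw [Pi.single_eq_of_ne hγ, Pi.single_eq_of_ne fun h => hγ (add_right_cancel h)]
        simp

end SummableSequences

/-! ### Mixing of translations and Birkhoff's criterion. -/

section Mixing

variable {𝕜 : Type*} [RCLike 𝕜]

theorem separableSpace_lp_one {ι : Type*} [Countable ι] :
    TopologicalSpace.SeparableSpace (lp (fun _ : ι => 𝕜) 1) := by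
  classical
  rw [← TopologicalSpace.isSeparable_univ_iff]
  refine (((Set.countable_range fun i : ι =>
    (lp.single 1 i (1 : 𝕜) : lp (fun _ : ι => 𝕜) 1)).isSeparable.span (R := 𝕜)).closure).mono
    fun a _ => mem_closure_of_tendsto (lp_one_hasSum_single a) (Eventually.of_forall fun F => ?_)
  refine Submodule.sum_mem _ fun i _ => ?_
  have h : (lp.single 1 i (a i) : lp (fun _ : ι => 𝕜) 1) = a i • lp.single 1 i (1 : 𝕜) := by
    rw [← lp.single_smul, smul_eq_mul, mul_one]
  rw [h]
  exact Submodule.smul_mem _ _ (Submodule.subset_span ⟨i, rfl⟩)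

/-- If the operators `S z` act as translations on a dense space of polynomials, then they are
topologically mixing. -/
theorem eventually_image_inter_nonempty_of_translatePoly {ι E : Type*} [Fintype ι] [Nonempty ι]
    [NormedAddCommGroup E] [NormedSpace 𝕜 E] (S : (ι → 𝕜) → E → E)
    (P : MvPolynomial ι 𝕜 →ₗ[𝕜] E) (hP : DenseRange P)
    (hS : ∀ z p, S z (P p) = P (translatePoly z p)) {U V : Set E} (hU : IsOpen U)
    (hV : IsOpen V) (hU' : U.Nonempty) (hV' : V.Nonempty) :
    ∀ᶠ z in Bornology.cobounded (ι → 𝕜), (S z '' U ∩ V).Nonempty := by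
  obtain ⟨q, hq⟩ := hP.exists_mem_open hU hU'
  obtain ⟨p, hp⟩ := hP.exists_mem_open hV hV'
  -- The region where coordinate `j` is largest is treated separately for each `j`; these finitely
  -- many regions cover the space.
  have key : ∀ j : ι, ∀ᶠ z in Bornology.cobounded (ι → 𝕜),
      (∀ i, ‖z i‖ ≤ ‖z j‖) → (S z '' U ∩ V).Nonempty := by
    intro j
    refine (eventually_inf_principal (p := fun z : ι → 𝕜 => (S z '' U ∩ V).Nonempty)
      (s := {z : ι → 𝕜 | ∀ i, ‖z i‖ ≤ ‖z j‖})).1 ?_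
    set l := Bornology.cobounded (ι → 𝕜) ⊓ 𝓟 {z | ∀ i, ‖z i‖ ≤ ‖z j‖}
    have hmax : ∀ᶠ z in l, ∀ i, ‖z i‖ ≤ ‖z j‖ := mem_inf_of_right (mem_principal_self _)
    have hnorm : Tendsto (fun z : ι → 𝕜 => ‖z j‖) l atTop := by
      refine tendsto_atTop_mono' l ?_ (tendsto_norm_cobounded_atTop.mono_left inf_le_left)
      filter_upwards [hmax] with z hz
      exact (pi_norm_le_iff_of_nonneg (norm_nonneg _)).2 hz
    have hinv : Tendsto (fun z : ι → 𝕜 => (z j)⁻¹) l (𝓝 0) := by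
      rw [tendsto_zero_iff_norm_tendsto_zero]
      simp only [norm_inv]
      exact tendsto_inv_atTop_zero.comp hnorm
    have hne : ∀ᶠ z in l, z j ≠ 0 := by
      filter_upwards [hnorm.eventually_gt_atTop 0] with z hz
      exact norm_pos_iff.1 hz
    have hneg : Tendsto (fun z : ι → 𝕜 => -z) l (map (fun z => -z) l) := tendsto_map
    obtain ⟨N₁, h₁⟩ := exists_tendsto_translatePoly_mul_pow_zero (E := E) j
      (map (fun z : ι → 𝕜 => -z) l)
      (tendsto_map'_iff.2 (by simpa only [Function.comp_def, Pi.neg_apply, norm_neg] using hnorm))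
      (by simpa only [eventually_map, Pi.neg_apply, norm_neg] using hmax) p
    obtain ⟨N₂, h₂⟩ := exists_tendsto_translatePoly_mul_pow_zero (E := E) j l hnorm hmax q
    let N := max N₁ N₂
    -- The two signs cancel, so the first summand is `(X j / z j) ^ N` times the translate of `p` by
    -- `-z`. Translation by `z` turns `1 - X j / z j` into `-X j / z j`.
    let a : (ι → 𝕜) → MvPolynomial ι 𝕜 := fun z =>
      (-1 : 𝕜) ^ N • (((-z) j)⁻¹ ^ N) • (translatePoly (-z) p * MvPolynomial.X j ^ N)
        + q * (1 + (-(z j)⁻¹) • MvPolynomial.X j) ^ N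
    have ha₁ : Tendsto (fun z => P (a z)) l (𝓝 (P q)) := by
      have t₁ := (((h₁ N (le_max_left _ _) P).comp hneg).const_smul ((-1 : 𝕜) ^ N)).add
        (tendsto_mul_one_add_smul_X_pow l (fun z : ι → 𝕜 => -(z j)⁻¹) (by simpa using hinv.neg)
          j N q P)
      rw [smul_zero, zero_add] at t₁
      refine t₁.congr fun z => ?_
      simp only [a, map_add, map_smul, Function.comp_apply]
    have ha₂ : Tendsto (fun z => S z (P (a z))) l (𝓝 (P p)) := by
      have t₂ := (tendsto_mul_one_add_smul_X_pow l (fun z : ι → 𝕜 => (z j)⁻¹) hinv j N p P).add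
        ((h₂ N (le_max_right _ _) P).const_smul ((-1 : 𝕜) ^ N))
      rw [smul_zero, add_zero] at t₂
      refine t₂.congr' ?_
      filter_upwards [hne] with z hz
      rw [hS, ← map_smul, ← map_smul, ← map_add]
      congr 1
      simp only [a, map_add, map_mul, map_pow, map_one, translatePoly_X, translatePoly_C,
        translatePoly_translatePoly_neg, MvPolynomial.smul_eq_C_mul, map_neg, Pi.neg_apply]
      have hC : MvPolynomial.C (z j)⁻¹ * MvPolynomial.C (z j) = (1 : MvPolynomial ι 𝕜) := by
        rw [← map_mul, inv_mul_cancel₀ hz, map_one]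
      have e1 : (1 : MvPolynomial ι 𝕜) + -MvPolynomial.C (z j)⁻¹ *
          (MvPolynomial.X j + MvPolynomial.C (z j)) =
          (-1) * (MvPolynomial.C (z j)⁻¹ * MvPolynomial.X j) := by
        linear_combination -hC
      have e2 : (1 : MvPolynomial ι 𝕜) + MvPolynomial.C (z j)⁻¹ * MvPolynomial.X j =
          (-1) * (MvPolynomial.C (-z j)⁻¹ * (MvPolynomial.X j + MvPolynomial.C (z j))) := by
        rw [inv_neg, map_neg]
        linear_combination -hC
      rw [e1, e2, mul_pow, mul_pow, mul_pow, mul_pow]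
      ring
    filter_upwards [ha₁.eventually (hU.mem_nhds hq), ha₂.eventually (hV.mem_nhds hp)] with z h1 h2
    exact ⟨S z (P (a z)), ⟨_, h1, rfl⟩, h2⟩
  filter_upwards [eventually_all.2 key] with z hz
  obtain ⟨j, hj⟩ := Finite.exists_max fun i => ‖z i‖
  exact hz j hj

/-- Birkhoff's transitivity criterion for universality. -/
theorem isUniversalFamily_of_forall_exists_image_inter {E : Type*} [TopologicalSpace E]
    [BaireSpace E] [SecondCountableTopology E] [Nonempty E] (S : ℕ → E → E)
    (hS : ∀ n, Continuous (S n))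
    (h : ∀ U V : Set E, IsOpen U → IsOpen V → U.Nonempty → V.Nonempty →
      ∃ n, (S n '' U ∩ V).Nonempty) : IsUniversalFamily S := by
  let b := TopologicalSpace.countableBasis E
  have hb := TopologicalSpace.isBasis_countableBasis E
  have hd : Dense (⋂ v ∈ b, ⋃ n, S n ⁻¹' v) := by
    refine dense_biInter_of_isOpen
      (fun v hv => isOpen_iUnion fun n => (hb.isOpen hv).preimage (hS n))
      (TopologicalSpace.countable_countableBasis E) fun v hv => ?_
    refine dense_iff_inter_open.2 fun U hU hU' => ?_
    obtain ⟨n, _, ⟨x, hx, rfl⟩, hxv⟩ := h U v hU (hb.isOpen hv) hU'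
      (TopologicalSpace.nonempty_of_mem_countableBasis hv)
    exact ⟨x, hx, Set.mem_iUnion.2 ⟨n, hxv⟩⟩
  obtain ⟨x, hx⟩ := hd.nonempty
  refine ⟨x, hb.dense_iff.2 fun v hv _ => ?_⟩
  obtain ⟨n, hn⟩ := Set.mem_iUnion.1 (Set.mem_iInter₂.1 hx v hv)
  exact ⟨_, hn, n, rfl⟩

end Mixing

/-! ### Diagonal factorization of `ℓ¹ → X → ℓ¹`. -/

section Factorization

variable {𝕜 X : Type*} [RCLike 𝕜] [AddCommGroup X] [Module 𝕜 X] [TopologicalSpace X]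

/-- An element of the span of an equicontinuous set of functionals is bounded near zero. -/
theorem IsEquicontinuousSet.exists_bound_of_mem_span {A : Set (X →L[𝕜] 𝕜)} {U : Set X}
    (hU : ∀ f ∈ A, ∀ x ∈ U, ‖f x‖ ≤ 1) {f : X →L[𝕜] 𝕜} (hf : f ∈ Submodule.span 𝕜 A) :
    ∃ C : ℝ, 0 ≤ C ∧ ∀ x ∈ U, ‖f x‖ ≤ C := by
  induction hf using Submodule.span_induction with
  | mem f hf => exact ⟨1, zero_le_one, hU f hf⟩
  | zero => exact ⟨0, le_rfl, fun x _ => by simp⟩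
  | add f g _ _ hf hg =>
    obtain ⟨C, hC, hf⟩ := hf
    obtain ⟨D, hD, hg⟩ := hg
    exact ⟨C + D, add_nonneg hC hD, fun x hx =>
      (norm_add_le _ _).trans (add_le_add (hf x hx) (hg x hx))⟩
  | smul a f _ hf =>
    obtain ⟨C, hC, hf⟩ := hf
    refine ⟨‖a‖ * C, mul_nonneg (norm_nonneg _) hC, fun x hx => ?_⟩
    rw [FunLike.coe_smul, Pi.smul_apply, norm_smul]
    exact mul_le_mul_of_nonneg_left (hf x hx) (norm_nonneg _)

variable [IsTopologicalAddGroup X] [ContinuousSMul 𝕜 X]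

/-- A linearly independent equicontinuous sequence of functionals and a dense continuous image of
a separable F-space yield operators `ℓ¹ → X → ℓ¹`, the first one with dense range, whose
composition is diagonal with nonzero entries. -/
theorem exists_diagonal_factorization_of_denseRange {A Y : Type*} [DecidableEq A] (e : A ≃ ℕ)
    [AddCommGroup Y] [Module 𝕜 Y] [UniformSpace Y] [IsUniformAddGroup Y] [ContinuousSMul 𝕜 Y]
    [FirstCountableTopology Y] [CompleteSpace Y] [T2Space Y] [TopologicalSpace.SeparableSpace Y]
    (j : Y →L[𝕜] X) (hj : DenseRange j) (f : ℕ → X →L[𝕜] 𝕜) (hf : LinearIndependent 𝕜 f)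
    (hfe : IsEquicontinuousSet (Set.range f)) :
    ∃ (G : X →L[𝕜] lp (fun _ : A => 𝕜) 1) (J : lp (fun _ : A => 𝕜) 1 →L[𝕜] X) (d : A → 𝕜),
      (∀ α, d α ≠ 0) ∧ (∀ a α, G (J a) α = d α * a α) ∧ DenseRange J := by
  obtain ⟨U, hU, hfU⟩ := hfe
  let B : (X →L[𝕜] 𝕜) →ₗ[𝕜] Module.Dual 𝕜 Y :=
    { toFun := fun F => (F.comp j : Y →L[𝕜] 𝕜)
      map_add' := fun _ _ => rfl
      map_smul' := fun _ _ => rfl }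
  -- A continuous functional vanishing on the dense image of `Y` is zero, so restriction to `Y`
  -- loses nothing.
  have hB : Function.Injective B := fun F F' h =>
    DFunLike.coe_injective (hj.equalizer F.continuous F'.continuous
      (funext fun y => DFunLike.congr_fun h y))
  obtain ⟨x, h, hspan, hdiag, hoff, hdense⟩ := exists_biorthogonal_dense_span B hB f hf
  choose C hC0 hC using fun n => IsEquicontinuousSet.exists_bound_of_mem_span hfU (hspan n)
  obtain ⟨r, hr, J, hJ⟩ := exists_continuousLinearMap_hasSum
    (fun n => lpOneCoord (𝕜 := 𝕜) A (e.symm n))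
    (fun n a => lp.norm_apply_le_norm one_ne_zero a _) x
  -- Each `h n` is bounded on the common neighbourhood `U` by its own constant `C n`; this scaling
  -- makes the bounds summable, giving a continuous map into `ℓ¹`.
  let κ : ℕ → ℝ := fun n => (1 / 2) ^ n / (C n + 1)
  have hκ : ∀ n, 0 < κ n := fun n => div_pos (by positivity) (by linarith [hC0 n])
  obtain ⟨G, hG⟩ := exists_clm_lp_one (fun α : A => ((κ (e α) : ℝ) : 𝕜) • h (e α)) hU
    (summable_geometric_two.comp_injective e.injective) (fun α v hv => by
      rw [FunLike.coe_smul, Pi.smul_apply, norm_smul, RCLike.norm_ofReal, abs_of_pos (hκ _),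
        Function.comp_apply]
      simp only [κ]
      rw [div_mul_eq_mul_div, div_le_iff₀ (by linarith [hC0 (e α)])]
      exact mul_le_mul_of_nonneg_left ((hC _ v hv).trans (by linarith)) (by positivity))
  refine ⟨G, j.comp J, fun α => (κ (e α) : 𝕜) * r (e α), fun α =>
    mul_ne_zero (RCLike.ofReal_ne_zero.2 (hκ _).ne') (hr _), fun a α => ?_, ?_⟩
  · have hval : h (e α) (j (J a)) = a α * r (e α) := by
      have hs := (hJ a).mapL ((h (e α)).comp j)
      refine hs.unique ?_
      have h1 := hasSum_single (f := fun n => ((h (e α)).comp j)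
        (lpOneCoord (𝕜 := 𝕜) A (e.symm n) a • r n • x n)) (e α) (fun n hn => by
          have : ((h (e α)).comp j) (x n) = 0 := hoff (e α) n hn.symm
          rw [map_smul, map_smul, this, smul_zero, smul_zero])
      have h2 : ((h (e α)).comp j) (x (e α)) = 1 := hdiag (e α)
      simpa only [map_smul, h2, Equiv.symm_apply_apply, lpOneCoord_apply, smul_eq_mul,
        mul_one] using h1
    rw [hG, FunLike.coe_smul, Pi.smul_apply, ContinuousLinearMap.comp_apply, hval, smul_eq_mul]
    ring
  · have hmem : Submodule.span 𝕜 (Set.range x) ≤ J.range := by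
      rw [Submodule.span_le]
      rintro _ ⟨n, rfl⟩
      refine ⟨(r n)⁻¹ • lp.single 1 (e.symm n) (1 : 𝕜), ?_⟩
      have h1 : J (lp.single 1 (e.symm n) (1 : 𝕜)) = r n • x n := by
        refine (hJ _).unique ?_
        have h2 := hasSum_single (f := fun m => lpOneCoord (𝕜 := 𝕜) A (e.symm m)
          (lp.single 1 (e.symm n) (1 : 𝕜)) • r m • x m) n (fun m hm => by
            rw [lpOneCoord_apply, lp.single_apply,
              Pi.single_eq_of_ne fun hmn => hm (e.symm.injective hmn), zero_smul])
        simpa only [lpOneCoord_apply, lp.single_apply_self, one_smul] using h2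
      change J _ = x n
      rw [map_smul, h1, inv_smul_smul₀ (hr n)]
    have hJd : DenseRange J := hdense.mono fun y hy => hmem hy
    exact hj.comp hJd j.continuous

theorem ClassM.exists_diagonal_factorization (hX : ClassM 𝕜 X) {A : Type*} [DecidableEq A]
    (e : A ≃ ℕ) :
    ∃ (G : X →L[𝕜] lp (fun _ : A => 𝕜) 1) (J : lp (fun _ : A => 𝕜) 1 →L[𝕜] X) (d : A → 𝕜),
      (∀ α, d α ≠ 0) ∧ (∀ a α, G (J a) α = d α * a α) ∧ DenseRange J := by
  obtain ⟨⟨Y, hY, τ, hτ, hF, hsep⟩, f, hf, hfe⟩ := hX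
  have hcont : @Continuous Y X τ _ Subtype.val := continuous_le_dom hτ continuous_subtype_val
  have hrange : DenseRange (Subtype.val : Y → X) := hY.denseRange_val
  let _ := τ
  have := hF.isTopologicalAddGroup
  have := hF.continuousSMul
  have := hF.metrizableSpace
  let _ : UniformSpace Y := IsTopologicalAddGroup.rightUniformSpace Y
  have := hF.completeSpace
  have : IsUniformAddGroup Y := isUniformAddGroup_of_addCommGroup
  exact exists_diagonal_factorization_of_denseRange e ⟨Y.subtype, hcont⟩ hrange f hf hfe

end Factorization

/-! ### Construction of the group on `X`. -/

theorem mainTheorem1 {𝕜 X : Type*} [RCLike 𝕜] [AddCommGroup X] [Module 𝕜 X]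
    [TopologicalSpace X] [IsTopologicalAddGroup X] [ContinuousSMul 𝕜 X] [T2Space X]
    (hX : ClassM 𝕜 X) (k : ℕ) (hk : 1 ≤ k) :
    ∃ T : EuclideanSpace 𝕜 (Fin k) → (X →L[𝕜] X),
      IsOperatorSemigroup T ∧ IsUniformlyContinuousFamily T ∧
      IsHereditarilyHypercyclic T ∧ IsMixing T ∧
      ∀ (x : X) (f : X →L[𝕜] 𝕜) (z : EuclideanSpace 𝕜 (Fin k)),
        AnalyticAt 𝕜 (fun w : EuclideanSpace 𝕜 (Fin k) => f (T w x)) z := by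
  have : Nonempty (Fin k) := ⟨⟨0, hk⟩⟩
  obtain ⟨e⟩ : Nonempty ((Fin k →₀ ℕ) ≃ ℕ) := nonempty_equiv_of_countable
  obtain ⟨G, J, d, hd, hGJ, hJ⟩ := hX.exists_diagonal_factorization e
  obtain ⟨s, hs, B, hB⟩ := exists_weighted_backward_shifts d hd
  -- At `α` both sides are `s α / (s β * d β) * a β`, where `β = α + eᵢ + eⱼ`.
  have hcomm : ∀ i j a, B i (G (J (B j a))) = B j (G (J (B i a))) := by
    intro i j a
    ext α
    simp only [hB, hGJ]
    rw [add_right_comm α (Finsupp.single j 1) (Finsupp.single i 1)]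
    have h1 := hs (α + Finsupp.single i 1)
    have h2 := hs (α + Finsupp.single j 1)
    have h3 := hd (α + Finsupp.single i 1)
    have h4 := hd (α + Finsupp.single j 1)
    field_simp
  let P := polyToLp (ι := Fin k) s
  have hP : ∀ i p, B i (G (J (P p))) = P (MvPolynomial.pderiv i p) := fun i p =>
    shift_polyToLp hs hd i ((B i).comp (G.comp J) : _ →L[𝕜] _)
      (fun a α => by
        change B i (G (J a)) α = _
        rw [hB, hGJ]) p
  let L : EuclideanSpace 𝕜 (Fin k) →L[𝕜] (Fin k → 𝕜) := EuclideanSpace.equiv (Fin k) 𝕜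
  let T : EuclideanSpace 𝕜 (Fin k) → (X →L[𝕜] X) := fun z => factoredExp G J B (L z)
  let S : (Fin k → 𝕜) → lp (fun _ : Fin k →₀ ℕ => 𝕜) 1 →L[𝕜] lp (fun _ : Fin k →₀ ℕ => 𝕜) 1 :=
    fun z => factoredExpLift G J B z
  have hTS : ∀ z a, T z (J a) = J (S (L z) a) := fun z a => factoredExp_comp G J B (L z) a
  have hL : Tendsto L (Bornology.cobounded _) (Bornology.cobounded _) :=
    (EuclideanSpace.equiv (Fin k) 𝕜).antilipschitz.tendsto_cobounded
  have hmix : ∀ U V : Set (lp (fun _ : Fin k →₀ ℕ => 𝕜) 1), IsOpen U → IsOpen V → U.Nonempty →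
      V.Nonempty → ∀ᶠ z in Bornology.cobounded (EuclideanSpace 𝕜 (Fin k)),
        (S (L z) '' U ∩ V).Nonempty := fun U V hU hV hU' hV' =>
    hL.eventually (eventually_image_inter_nonempty_of_translatePoly (fun z => S z) P
      (denseRange_polyToLp hs) (factoredExpLift_apply_eq_translatePoly G J B P hP) hU hV hU' hV')
  have hsep : TopologicalSpace.SeparableSpace (lp (fun _ : Fin k →₀ ℕ => 𝕜) 1) :=
    separableSpace_lp_one
  have := UniformSpace.secondCountable_of_separable (lp (fun _ : Fin k →₀ ℕ => 𝕜) 1)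
  refine ⟨T, ⟨?_, fun z w => ?_⟩, ?_, fun t ht => ?_, fun U V hU hV hU' hV' => ?_, fun x f z => ?_⟩
  · simp only [T, map_zero, factoredExp_zero]
  · simp only [T, map_add]
    exact factoredExp_add G J B hcomm _ _
  · obtain ⟨U, hU, h⟩ := exists_nhds_tendstoUniformly_factoredExp G J B
    exact ⟨U, hU, fun t a hta => h _ _ ((L.continuous.tendsto a).comp hta)⟩
  · rw [tendsto_norm_atTop_iff_cobounded] at ht
    obtain ⟨a, ha⟩ := isUniversalFamily_of_forall_exists_image_inter
      (fun n a => S (L (t n)) a) (fun n => (S (L (t n))).continuous)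
      fun U V hU hV hU' hV' => (ht.eventually (hmix U V hU hV hU' hV')).exists
    refine ⟨J a, ?_⟩
    -- A continuous map with dense range carries the dense orbit in `ℓ¹` to a dense orbit in `X`.
    have h := hJ.dense_image J.continuous ha
    rw [← Set.range_comp] at h
    simpa only [hTS, Function.comp_def] using h
  · have h := hmix (J ⁻¹' U) (J ⁻¹' V) (hU.preimage J.continuous) (hV.preimage J.continuous)
      (hJ.exists_mem_open hU hU') (hJ.exists_mem_open hV hV')
    obtain ⟨r, -, hr⟩ := hasBasis_cobounded_norm.eventually_iff.1 h
    refine ⟨max r 1, lt_max_of_lt_right one_pos, fun z hz => ?_⟩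
    obtain ⟨_, ⟨a, ha, rfl⟩, hav⟩ := hr (le_of_lt (lt_of_le_of_lt (le_max_left r 1) hz))
    exact ⟨T z (J a), ⟨J a, ha, rfl⟩, by rw [hTS]; exact hav⟩
  · exact (analyticAt_factoredExp G J B x f (L z)).comp (L.analyticAt z)
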